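/- Write $e_t(x)=e^{2\pi i t x}$. Let $R=3$, $B=\{0,2\}$, $L=\{0,3/4\}$, $\tau_b(x)=\frac{x+b}{3}$ for $b\in B$, and let $X_B=\{\sum_{k\ge1}3^{-k}b_k : b_k\in B\}$ be the attractor of the iterated function system $(\tau_b)_{b\in B}$. Let $\mu_B$ be its invariant measure, i.e. the Borel probability measure on $\mathbb R$ with $\int f\,d\mu_B=\frac12\sum_{b\in B}\int f\circ\tau_b\,d\mu_B$ for all continuous compactly supported $f$. Let $m_B(x)=\frac12\sum_{b\in B}e^{2\pi i b x}$. An *extreme cycle* for $(B,L)$ is a set $\{c_0,\dots,c_{p-1}\}\subset\mathbb R$, $p\ge1$, such that for some $l_0,\dots,l_{p-1}\in L$ we have $c_{i+1}=\frac{c_i+l_i}{3}$ for $0\le i<p$, with $c_p=c_0$, and $|m_B(c_i)|=1$ for all $i$; its elements are called *extreme cycle points*. Then: 1. $X_B$ is the middle-third Cantor set, and $L$ is a spectrum for $\frac13B$, i.e. $|L|=|B|=2$ and the matrix $\frac1{\sqrt2}\big[e^{2\pi i a l}\big]_{a\in\frac13B,\;l\in L}$ is unitary. 2. The only extreme cycle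 for $(B,L)$ is $\{0\}$, and the only extreme cycle point is $0$. 3. The system has no overlap: $\mu_B(\tau_0(X_B)\cap\tau_2(X_B))=0$. The map $r$ given $\mu_B$-almost everywhere by $r(x)=3x-b$ for $x\in\tau_b(X_B)$ preserves $\mu_B$, so that $S_lf=e_l\cdot(f\circ r)$, $l\in L$, are isometries of $L^2(\mu_B)$. With $S_w=S_{l_1}S_{l_2}\cdots S_{l_n}$ for a word $w=l_1\cdots l_n$ (and $S_\emptyset=I$), the set $\{S_w1 : w\in\{0,3/4\}^*\}$, where $\{0,3/4\}^*$ is the set of all finite words with digits in $L$, including the empty one, and repeated vectors are counted once, is an orthonormal basis of $L^2(\mu_B)$. 4. The functions $S_w1$ are piecewise exponential with phase factors $\pm1$: for every $n\ge0$ and $l_1,\dots,l_n\in L$, $\mu_B$-almost every $x$ lies in $\tau_{b_1}\cdots\tau_{b_n}(X_B)$ for some $b_1,\dots,b_n\in B$, and whenever it does, $$S_{l_1\cdots l_n}1(x)=e^{2\pi i\alpha(b,l)}\,e_{l_1+3l_2+\cdots+3^{n-1}l_n}(x),\qquad \alpha(b,l)=-\sum_{k=2}^{n}\Big(\sum_{j=1}^{k-1}3^{k-1-j}b_j\Big)l_k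 ;$$ moreover $e^{2\pi i\alpha(b,l)}\in\{1,-1\}$ for all $b_1,\dots,b_n\in B$. -/

import Mathlib

open MeasureTheory

noncomputable section

namespace PiecewiseExp

/-- The exponential function `e_t(x) = exp(2 π i t x)`. -/
def expFun (t x : ℝ) : ℂ := Complex.exp (2 * Real.pi * Complex.I * t * x)

/-- `Λ` is a spectrum for the finite set `A`: `|Λ| = |A| = N` and the matrix
`N^{-1/2} [exp(2 π i a t)]`, `a ∈ A`, `t ∈ Λ`, is unitary. -/
def IsSpectrum (A Λ : Finset ℝ) : Prop :=
  Λ.card = A.card ∧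
    let M : Matrix A Λ ℂ := fun a t => ((Real.sqrt A.card : ℝ) : ℂ)⁻¹ * expFun t a
    M * M.conjTranspose = 1 ∧ M.conjTranspose * M = 1

/-- The maps `τ_b(x) = R⁻¹ (x + b)` of the iterated function system given by `R`, `b ∈ B`. -/
def tau (R b x : ℝ) : ℝ := R⁻¹ * (x + b)

/-- The attractor `X_B` of the iterated function system `(τ_b)_{b ∈ B}`: the set of all sums
`∑_{k ≥ 1} R^{-k} b_k` with digits `b_k ∈ B`. -/
def attractor (R : ℝ) (B : Finset ℝ) : Set ℝ :=
  {x | ∃ b : ℕ → ℝ, (∀ k, b k ∈ B) ∧ HasSum (fun k => (R ^ (k + 1))⁻¹ * b k) x}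

/-- The probability measure `μ` is the invariant measure of the iterated function system
`(τ_b)_{b ∈ B}`: it satisfies `∫ f dμ = N⁻¹ ∑_b ∫ f ∘ τ_b dμ` for all continuous functions `f` with
compact support. -/
def IsInvariantMeasure (R : ℝ) (B : Finset ℝ) (μ : Measure ℝ) [IsProbabilityMeasure μ] : Prop :=
  ∀ f : ℝ → ℝ, Continuous f → HasCompactSupport f →
    ∫ x, f x ∂μ = (B.card : ℝ)⁻¹ * ∑ b ∈ B, ∫ x, f (tau R b x) ∂μ

/-- An invariant measure exists: the law of `∑_{k ≥ 1} R^{-k} b_k` for independent digits `b_k`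
uniformly distributed in `B`. -/
lemma exists_isInvariantMeasure (R : ℝ) (hR : 1 < R) (B : Finset ℝ) (hB : B.Nonempty) :
    ∃ (μ : Measure ℝ) (_ : IsProbabilityMeasure μ), IsInvariantMeasure R B μ := by
  classical
  have : Nonempty B := hB.to_subtype
  let P : Measure B := ProbabilityTheory.uniformOn Set.univ
  have : IsProbabilityMeasure P := ProbabilityTheory.isProbabilityMeasure_uniformOn Set.finite_univ Set.univ_nonempty
  let ν : Measure (ℕ → B) := Measure.infinitePi fun _ => P
  let T : B × (ℕ → B) → (ℕ → B) := fun p n => Nat.casesOn n p.1 p.2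
  have hT : Measurable T := by
    refine measurable_pi_lambda _ fun n => ?_
    cases n with
    | zero => exact measurable_fst
    | succ n => exact (measurable_pi_apply n).comp measurable_snd
  have hTν : Measure.map T (P.prod ν) = ν := by
    refine Measure.eq_infinitePi _ fun s t ht => ?_
    rw [Measure.map_apply hT (MeasurableSet.pi s.countable_toSet fun i _ => ht i)]
    let s' : Finset ℕ := s.preimage Nat.succ (Nat.succ_injective.injOn)
    have hset : T ⁻¹' (Set.pi s t) =
        (if 0 ∈ s then t 0 else Set.univ) ×ˢ (Set.pi s' fun i => t (i + 1)) := by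
      ext ⟨b, ω⟩
      simp only [Set.mem_preimage, Set.mem_pi, Set.mem_prod, Finset.mem_coe, s', Finset.mem_preimage]
      constructor
      · intro h
        refine ⟨?_, fun i hi => h (i+1) hi⟩
        split_ifs with h0
        · exact h 0 h0
        · trivial
      · rintro ⟨h1, h2⟩ i hi
        cases i with
        | zero => rw [if_pos hi] at h1; exact h1
        | succ i => exact h2 i hi
    rw [hset, Measure.prod_prod, Measure.infinitePi_pi _ (fun i _ => ht _)]
    have hprod : ∏ i ∈ s', P (t (i+1)) = ∏ i ∈ s.erase 0, P (t i) := by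
      refine Finset.prod_bij (fun i _ => i + 1) ?_ ?_ ?_ ?_
      · intro i hi; simpa [s'] using hi
      · intro i _ j _ h; simpa using h
      · intro i hi
        obtain ⟨h0, h1⟩ := Finset.mem_erase.1 hi
        obtain ⟨j, rfl⟩ := Nat.exists_eq_succ_of_ne_zero h0
        exact ⟨j, by simpa [s'] using h1, rfl⟩
      · intros; rfl
    rw [hprod]
    split_ifs with h0
    · rw [Finset.mul_prod_erase s (fun i => P (t i)) h0]
    · rw [Finset.erase_eq_of_notMem h0]; simp
  obtain ⟨C, hC⟩ : ∃ C : ℝ, ∀ b ∈ B, |b| ≤ C := by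
    obtain ⟨C, hC⟩ := (B.image fun b => |b|).exists_le
    exact ⟨C, fun b hb => hC _ (Finset.mem_image_of_mem _ hb)⟩
  have hR0 : 0 < R := by linarith
  have hsum : ∀ ω : ℕ → B, Summable fun k => (R ^ (k + 1))⁻¹ * (ω k : ℝ) := by
    intro ω
    have hg : Summable fun k : ℕ => (R⁻¹) ^ (k+1) * C :=
      (((summable_nat_add_iff 1).2 (summable_geometric_of_lt_one (by positivity) (inv_lt_one_of_one_lt₀ hR)))).mul_right C
    refine Summable.of_norm_bounded hg fun k => ?_
    rw [norm_mul, inv_pow, Real.norm_of_nonneg (by positivity)]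
    exact mul_le_mul_of_nonneg_left (hC _ (ω k).2) (by positivity)
  let g : (ℕ → B) → ℝ := fun ω => ∑' k, (R ^ (k + 1))⁻¹ * (ω k : ℝ)
  have hg : Measurable g := by
    refine measurable_of_tendsto_metrizable (f := fun n ω => ∑ k ∈ Finset.range n, (R ^ (k + 1))⁻¹ * (ω k : ℝ)) ?_ ?_
    · intro n
      refine Finset.measurable_sum _ fun k _ => ?_
      exact (measurable_subtype_coe.comp (measurable_pi_apply k)).const_mul _
    · exact tendsto_pi_nhds.2 fun ω => (hsum ω).hasSum.tendsto_sum_nat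
  have hgT : ∀ b ω, g (T (b, ω)) = tau R b (g ω) := by
    intro b ω
    change ∑' k, _ = _
    rw [(hsum _).tsum_eq_zero_add]
    simp only [T, tau, g]
    rw [mul_add, add_comm, ← tsum_mul_left]
    congr 1
    · refine tsum_congr fun k => ?_
      rw [pow_succ' R (k+1), mul_inv, mul_assoc]
    · simp
  have : IsProbabilityMeasure (ν.map g) := Measure.isProbabilityMeasure_map hg.aemeasurable
  refine ⟨ν.map g, inferInstance, fun f hf hfc => ?_⟩
  have hfm : ∀ h : ℝ → ℝ, Continuous h → ∫ x, h x ∂(ν.map g) = ∫ ω, h (g ω) ∂ν := fun h hh =>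
    integral_map hg.aemeasurable hh.aestronglyMeasurable
  obtain ⟨K, hK⟩ := hf.bounded_above_of_compact_support hfc
  rw [hfm f hf]
  have e1 : ∫ ω, f (g ω) ∂ν = ∫ p, f (g (T p)) ∂(P.prod ν) := by
    conv_lhs => rw [← hTν]
    exact integral_map hT.aemeasurable (hf.measurable.comp hg).aestronglyMeasurable
  have e2 : Integrable (fun p => f (g (T p))) (P.prod ν) := Integrable.of_bound
    (hf.measurable.comp (hg.comp hT)).aestronglyMeasurable K
    (Filter.Eventually.of_forall fun _ => hK _)
  rw [e1, integral_prod _ e2]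
  simp only [hgT]
  rw [integral_fintype (Integrable.of_finite)]
  have hP : ∀ b : B, P.real {b} = (B.card : ℝ)⁻¹ := by
    intro b
    simp [P, Measure.real, ProbabilityTheory.uniformOn_univ]
  simp only [hP, smul_eq_mul]
  rw [← Finset.mul_sum, ← Finset.sum_coe_sort B]
  congr 1
  refine Finset.sum_congr rfl fun b _ => ?_
  rw [hfm (fun x => f (tau R b x)) (by unfold tau; fun_prop)]

/-- The iterated function system has no overlap with respect to `μ`. -/
def NoOverlap (R : ℝ) (B : Finset ℝ) (μ : Measure ℝ) : Prop :=
  ∀ b ∈ B, ∀ b' ∈ B, b ≠ b' →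
    μ ((tau R b '' attractor R B) ∩ (tau R b' '' attractor R B)) = 0

open Classical in
/-- The map `r` with `r(x) = τ_b⁻¹(x) = R x - b` for `x ∈ τ_b(X_B)`. The value `0` outside the
attractor plays no role, and the choice of `b` plays none off the overlaps. -/
def shiftMap (R : ℝ) (B : Finset ℝ) (x : ℝ) : ℝ :=
  if h : ∃ b, b ∈ B ∧ x ∈ tau R b '' attractor R B then R * x - h.choose else 0

/-- The function `m_B(x) = N⁻¹ ∑_{b ∈ B} exp(2 π i b x)`. -/
def maskFun (B : Finset ℝ) (x : ℝ) : ℂ := (B.card : ℂ)⁻¹ * ∑ b ∈ B, expFun b x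

/-- `c 0, …, c (p - 1)` runs through an extreme cycle for `(B, L)`: each point is mapped to the
next one (and the last one to `c 0`) by some `t ↦ (t + l) / R` with `l ∈ L`, and `|m_B| = 1` at
each of them. -/
def IsExtremeCycleSeq (R : ℝ) (B L : Finset ℝ) (p : ℕ) (c : ℕ → ℝ) : Prop :=
  0 < p ∧ c p = c 0 ∧
    ∀ i < p, (∃ l ∈ L, c (i + 1) = (c i + l) / R) ∧ ‖maskFun B (c i)‖ = 1

/-- `c` is an extreme cycle point for `(B, L)`. -/
def IsExtremeCyclePoint (R : ℝ) (B L : Finset ℝ) (c : ℝ) : Prop :=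
  ∃ (p : ℕ) (s : ℕ → ℝ), IsExtremeCycleSeq R B L p s ∧ s 0 = c

/-- The set `C` is an extreme cycle for `(B, L)`. -/
def IsExtremeCycle (R : ℝ) (B L : Finset ℝ) (C : Set ℝ) : Prop :=
  ∃ (p : ℕ) (s : ℕ → ℝ), IsExtremeCycleSeq R B L p s ∧ C = s '' {i | i < p}

lemma norm_expFun (t x : ℝ) : ‖expFun t x‖ = 1 := by
  have h : (2 * Real.pi * Complex.I * t * x : ℂ) = ((2 * Real.pi * t * x : ℝ) : ℂ) * Complex.I := by
    push_cast; ring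
  rw [expFun, h, Complex.norm_exp_ofReal_mul_I]

lemma continuous_expFun (t : ℝ) : Continuous (expFun t) := by
  unfold expFun; fun_prop

lemma eLpNorm_expFun_mul (μ : Measure ℝ) (t : ℝ) (f : ℝ → ℂ) :
    eLpNorm (fun x => expFun t x * f x) 2 μ = eLpNorm f 2 μ :=
  eLpNorm_congr_norm_ae (Filter.Eventually.of_forall fun x => by simp [norm_expFun])

lemma memLp_cuntz {μ : Measure ℝ} {r : ℝ → ℝ} (hr : MeasurePreserving r μ μ) (l : ℝ)
    (f : Lp ℂ 2 μ) : MemLp (fun x => expFun l x * f (r x)) 2 μ := by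
  have h := (Lp.memLp f).comp_measurePreserving hr
  refine ⟨(continuous_expFun l).aestronglyMeasurable.mul h.1, ?_⟩
  have := eLpNorm_expFun_mul μ l (f ∘ r)
  simp only [Function.comp_apply] at this
  rw [this]
  exact h.2

/-- The isometry `S_l f = e_l · (f ∘ r)` of `L²(μ)`. -/
def cuntzOp {μ : Measure ℝ} {r : ℝ → ℝ} (hr : MeasurePreserving r μ μ) (l : ℝ) :
    Lp ℂ 2 μ →ₗᵢ[ℂ] Lp ℂ 2 μ where
  toFun f := (memLp_cuntz hr l f).toLp (fun x => expFun l x * f (r x))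
  map_add' f g := by
    rw [← MemLp.toLp_add]
    refine MemLp.toLp_congr _ _ ?_
    filter_upwards [hr.quasiMeasurePreserving.ae (Lp.coeFn_add f g)] with x hx
    simp only [Pi.add_apply] at hx ⊢
    rw [hx]; ring
  map_smul' c f := by
    rw [RingHom.id_apply, ← MemLp.toLp_const_smul]
    refine MemLp.toLp_congr _ _ ?_
    filter_upwards [hr.quasiMeasurePreserving.ae (Lp.coeFn_smul c f)] with x hx
    simp only [Pi.smul_apply, smul_eq_mul] at hx ⊢
    rw [hx]; ring
  norm_map' f := by
    change ‖(memLp_cuntz hr l f).toLp (fun x => expFun l x * f (r x))‖ = ‖f‖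
    rw [Lp.norm_toLp, eLpNorm_expFun_mul μ l (fun x => f (r x)), Lp.norm_def]
    congr 1
    exact eLpNorm_comp_measurePreserving (Lp.aestronglyMeasurable f) hr

/-- `S_w f = S_{l_1} S_{l_2} ⋯ S_{l_n} f` for the word `w = l_1 l_2 ⋯ l_n`. -/
def cuntzWord {μ : Measure ℝ} {r : ℝ → ℝ} (hr : MeasurePreserving r μ μ) {L : Finset ℝ}
    (w : List L) (f : Lp ℂ 2 μ) : Lp ℂ 2 μ :=
  w.foldr (fun l g => cuntzOp hr l g) f

/-- The cylinder `τ_{b_1} τ_{b_2} ⋯ τ_{b_n} (X_B)`. -/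
def ifsCylinder (R : ℝ) (B : Finset ℝ) {n : ℕ} (b : Fin n → B) : Set ℝ :=
  (fun x => (List.ofFn b).foldr (fun d y => tau R d y) x) '' attractor R B

/-- The phase `α(b, l) = -[b_1 l_2 + (R b_1 + b_2) l_3 + ⋯ + (R^{n-2} b_1 + ⋯ + b_{n-1}) l_n]`
(with indices starting at `0` instead of `1`). -/
def phase (R : ℝ) {n : ℕ} (b l : Fin n → ℝ) : ℝ :=
  -∑ k : Fin n, (∑ j ∈ Finset.univ.filter (fun j : Fin n => j < k),
    R ^ ((k : ℕ) - 1 - (j : ℕ)) * b j) * l k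

/-- The frequency `l_1 + R l_2 + ⋯ + R^{n-1} l_n`. -/
def freq (R : ℝ) {n : ℕ} (l : Fin n → ℝ) : ℝ := ∑ k : Fin n, R ^ (k : ℕ) * l k

/-- The digits of the iterated function system of the middle-third Cantor set. -/
def cantorB : Finset ℝ := {0, 2}

/-- The set `{0, 3/4}`. -/
def cantorL : Finset ℝ := {0, 3 / 4}

end PiecewiseExp

end

open PiecewiseExp

namespace PiecewiseExp

/-! The whole argument rests on one relation between the digits and the frequencies: `expFun (±3/4)
(2/3) = -1`. It makes the matrix unitary. On the measure side, `expFun (±3/4)` takes opposite values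
at the two branches `tau 3 0 x` and `tau 3 2 x`. By self-similarity its product with any function of
`shiftMap` therefore integrates to zero (`integral_expFun_mul_comp_shiftMap`), so the two isometries
have orthogonal ranges. Since `S_0 1 = 1`, the empty word may be read as the word `0`, and comparing
first letters shows that two vectors `S_w 1` are equal or orthogonal
(`cuntzWord_eq_or_inner_eq_zero`). For completeness, let `Q` project onto the orthogonal complement
of the span `K` of the vectors `S_w 1`. It commutes with both isometries. Expanding `e_t` in the two
ranges (`expLp_eq_add`) shows that `u t = ‖Q e_t‖²` is an average of `u (t / 3)` and `u ((t - 3/4) /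
3)` with weights `|m_B|²`, that is, a squared cosine and a squared sine; also `u 0 = 0`. A maximum
principle (`eq_zero_of_averaging`) forces `u = 0`; it reflects the fact that `0` is the only extreme
cycle point. Every exponential then lies in the closure of `K`, and exponentials are total because a
finite measure is determined by its characteristic function. The phase formula follows by peeling
off one letter at a time. The signs arise because each digit is `0` or `2` and each frequency is an
integer multiple of `3/4`. -/

lemma mem_cantorB {b : ℝ} : b ∈ cantorB ↔ b = 0 ∨ b = 2 := by simp [cantorB]

lemma mem_cantorL {l : ℝ} : l ∈ cantorL ↔ l = 0 ∨ l = 3 / 4 := by simp [cantorL]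

lemma card_cantorB : cantorB.card = 2 := by simp [cantorB]

lemma card_cantorL : cantorL.card = 2 := by
  rw [cantorL, Finset.card_pair]; norm_num

lemma sum_cantorB {M : Type*} [AddCommMonoid M] (f : ℝ → M) :
    ∑ b ∈ cantorB, f b = f 0 + f 2 := by
  simp [cantorB]

lemma sum_cantorL {M : Type*} [AddCommMonoid M] (f : ℝ → M) :
    ∑ l ∈ cantorL, f l = f 0 + f (3 / 4) := by
  rw [cantorL, Finset.sum_pair]; norm_num

/-! ### The exponential functions -/

lemma expFun_zero_left (x : ℝ) : expFun 0 x = 1 := by simp [expFun]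

lemma expFun_zero_right (t : ℝ) : expFun t 0 = 1 := by simp [expFun]

lemma expFun_add_left (s t x : ℝ) : expFun (s + t) x = expFun s x * expFun t x := by
  simp only [expFun, ← Complex.exp_add]; push_cast; congr 1; ring

lemma expFun_add_right (t x y : ℝ) : expFun t (x + y) = expFun t x * expFun t y := by
  simp only [expFun, ← Complex.exp_add]; push_cast; congr 1; ring

lemma expFun_congr {s t x y : ℝ} (h : s * x = t * y) : expFun s x = expFun t y := by
  have h' : (s : ℂ) * x = t * y := by exact_mod_cast h
  simp only [expFun, mul_assoc, h']

lemma star_expFun (t x : ℝ) : (starRingEnd ℂ) (expFun t x) = expFun (-t) x := by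
  simp only [expFun, ← Complex.exp_conj]
  congr 1
  simp only [map_mul, map_ofNat, Complex.conj_ofReal, Complex.conj_I, Complex.ofReal_neg]
  ring

lemma expFun_eq_cos_add (t x : ℝ) :
    expFun t x = Real.cos (2 * Real.pi * (t * x)) + Real.sin (2 * Real.pi * (t * x)) * Complex.I := by
  have h : (2 * Real.pi * Complex.I * t * x : ℂ) = ((2 * Real.pi * (t * x) : ℝ) : ℂ) * Complex.I := by
    push_cast; ring
  rw [expFun, h, Complex.exp_mul_I, Complex.ofReal_cos, Complex.ofReal_sin]

lemma expFun_half {t x : ℝ} (h : t * x = 1 / 2) : expFun t x = -1 := by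
  have : 2 * Real.pi * (1 / 2) = Real.pi := by ring
  rw [expFun_eq_cos_add, h, this]
  simp

lemma expFun_neg_half {t x : ℝ} (h : t * x = -(1 / 2)) : expFun t x = -1 := by
  have : 2 * Real.pi * -(1 / 2) = -Real.pi := by ring
  rw [expFun_eq_cos_add, h, this]
  simp

lemma expFun_half_int {t x : ℝ} (m : ℤ) (h : t * x = m / 2) :
    expFun t x ∈ ({1, -1} : Set ℂ) := by
  have hsq : expFun t x * expFun t x = 1 := by
    rw [← expFun_add_left, expFun]
    have : (2 * Real.pi * Complex.I * ((t + t : ℝ) : ℂ) * x : ℂ) = m * (2 * Real.pi * Complex.I) := by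
      have h' : (t : ℂ) * x = m / 2 := by exact_mod_cast h
      push_cast
      linear_combination (4 * Real.pi * Complex.I) * h'
    rw [this, Complex.exp_int_mul_two_pi_mul_I]
  simpa using mul_self_eq_one_iff.1 hsq

/-! ### The attractor -/

theorem attractor_cantorB : attractor 3 cantorB = cantorSet := by
  rw [cantorSet_eq_zero_two_ofDigits]
  ext x
  constructor
  · rintro ⟨b, hb, hx⟩
    refine ⟨fun k => if b k = 0 then 0 else 2, fun i => by beta_reduce; split_ifs <;> decide, ?_⟩
    rw [Real.ofDigits, ← hx.tsum_eq]
    refine tsum_congr fun k => ?_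
    rcases mem_cantorB.1 (hb k) with h | h <;> simp [Real.ofDigitsTerm, h, mul_comm]
  · rintro ⟨a, ha, rfl⟩
    refine ⟨fun k => ((a k : ℕ) : ℝ), fun k => ?_, ?_⟩
    · have h : ∀ d : Fin 3, d ≠ 1 → ((d : ℕ) : ℝ) ∈ cantorB := by
        intro d hd
        fin_cases d <;> simp_all [mem_cantorB]
      exact h _ (ha k)
    · have := (Real.summable_ofDigitsTerm (digits := a)).hasSum
      convert! this using 2 with k
      simp [Real.ofDigitsTerm, mul_comm]

lemma cantorSet_eq_iUnion_tau :
    cantorSet = tau 3 0 '' cantorSet ∪ tau 3 2 '' cantorSet := by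
  have h0 : tau 3 0 = (· / 3) := by funext x; simp only [tau]; ring
  have h2 : tau 3 2 = fun x => (2 + x) / 3 := by funext x; simp only [tau]; ring
  rw [h0, h2]
  exact cantorSet_eq_union_halves

lemma tau_mem_cantorSet {b x : ℝ} (hb : b ∈ cantorB) (hx : x ∈ cantorSet) :
    tau 3 b x ∈ cantorSet := by
  rw [cantorSet_eq_iUnion_tau]
  rcases mem_cantorB.1 hb with rfl | rfl
  · exact Or.inl ⟨x, hx, rfl⟩
  · exact Or.inr ⟨x, hx, rfl⟩

/-- The two branches land in `[0, 1/3]` and `[2/3, 1]`. This separation gives the absence of overlap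
and makes the choice inside `shiftMap` harmless. -/
lemma digit_eq_of_tau_eq {b b' x y : ℝ} (hb : b ∈ cantorB) (hb' : b' ∈ cantorB)
    (hx : x ∈ cantorSet) (hy : y ∈ cantorSet) (h : tau 3 b x = tau 3 b' y) : b = b' := by
  have h1 := cantorSet_subset_unitInterval hx
  have h2 := cantorSet_subset_unitInterval hy
  simp only [tau, Set.mem_Icc] at *
  rcases mem_cantorB.1 hb with rfl | rfl <;> rcases mem_cantorB.1 hb' with rfl | rfl <;>
    first | rfl | linarith

lemma shiftMap_tau {b x : ℝ} (hb : b ∈ cantorB) (hx : x ∈ cantorSet) :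
    shiftMap 3 cantorB (tau 3 b x) = x := by
  have h : ∃ d, d ∈ cantorB ∧ tau 3 b x ∈ tau 3 d '' attractor 3 cantorB :=
    ⟨b, hb, x, by rwa [attractor_cantorB], rfl⟩
  rw [shiftMap, dif_pos h]
  obtain ⟨hd, y, hy, hxy⟩ := h.choose_spec
  rw [attractor_cantorB] at hy
  rw [digit_eq_of_tau_eq hd hb hy hx hxy]
  simp only [tau]; ring

/-! ### The spectrum of the digit set -/

theorem isSpectrum_cantorL :
    IsSpectrum (cantorB.image (fun b => (3 : ℝ)⁻¹ * b)) cantorL := by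
  have hA : cantorB.image (fun b => (3 : ℝ)⁻¹ * b) = {0, 2 / 3} := by
    simp only [cantorB, Finset.image_insert, Finset.image_singleton]; norm_num
  rw [hA]
  have hc : ({0, 2 / 3} : Finset ℝ).card = 2 := by rw [Finset.card_pair]; norm_num
  refine ⟨by rw [hc, card_cantorL], ?_⟩
  intro M
  have hM : M * M.conjTranspose = 1 := by
    ext ⟨a, ha⟩ ⟨a', ha'⟩
    have hs : (((Real.sqrt 2 : ℝ) : ℂ))⁻¹ * (((Real.sqrt 2 : ℝ) : ℂ))⁻¹ = 2⁻¹ := by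
      rw [← mul_inv, ← Complex.ofReal_mul, Real.mul_self_sqrt (by norm_num)]; norm_num
    have hsum : ((M * M.conjTranspose) ⟨a, ha⟩ ⟨a', ha'⟩ : ℂ) =
        ∑ l ∈ cantorL, 2⁻¹ * (expFun l a * expFun (-l) a') := by
      rw [Matrix.mul_apply, ← Finset.sum_coe_sort cantorL]
      refine Finset.sum_congr rfl fun l _ => ?_
      have hct : M.conjTranspose l ⟨a', ha'⟩ = star (M ⟨a', ha'⟩ l) := rfl
      rw [hct]
      simp only [M, hc, star_mul', RCLike.star_def, star_expFun,
        map_inv₀, Complex.conj_ofReal, Nat.cast_ofNat]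
      linear_combination expFun l a * expFun (-l) a' * hs
    rw [hsum, sum_cantorL, expFun_zero_left, neg_zero, expFun_zero_left]
    have e1 : expFun (3 / 4) (2 / 3) = -1 := expFun_half (by norm_num)
    have e2 : expFun (-(3 / 4)) (2 / 3) = -1 := expFun_neg_half (by norm_num)
    simp only [Finset.mem_insert, Finset.mem_singleton] at ha ha'
    rcases ha with rfl | rfl <;> rcases ha' with rfl | rfl <;>
      simp [Matrix.one_apply, expFun_zero_right, e1, e2] <;> norm_num
  refine ⟨hM, ?_⟩
  rwa [Matrix.mul_eq_one_comm_of_card_eq] at hM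
  simp [hc, card_cantorL]

/-! ### Extreme cycles -/

lemma maskFun_cantorB (x : ℝ) : maskFun cantorB x = 2⁻¹ * (1 + expFun 2 x) := by
  rw [maskFun, sum_cantorB, card_cantorB, expFun_zero_left]; norm_num

lemma normSq_maskFun_cantorB (x : ℝ) :
    ‖maskFun cantorB x‖ ^ 2 = Real.cos (2 * Real.pi * x) ^ 2 := by
  rw [maskFun_cantorB, expFun_eq_cos_add, ← Complex.normSq_eq_norm_sq]
  have h : 2 * Real.pi * (2 * x) = 2 * (2 * Real.pi * x) := by ring
  rw [h, Real.cos_two_mul, Real.sin_two_mul]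
  simp only [Complex.normSq_apply, Complex.mul_re, Complex.mul_im, Complex.add_re, Complex.add_im,
    Complex.one_re, Complex.one_im, Complex.ofReal_re, Complex.ofReal_im, Complex.I_re,
    Complex.I_im, Complex.inv_re, Complex.inv_im]
  norm_num
  have := Real.sin_sq_add_cos_sq (2 * Real.pi * x)
  linear_combination Real.cos (2 * Real.pi * x) ^ 2 * this

lemma norm_maskFun_zero : ‖maskFun cantorB 0‖ = 1 := by
  rw [maskFun_cantorB, expFun_zero_right]; norm_num

/-- Modulus one means `cos² (2πx) = 1`, so `sin (2πx) = 0`, whereas the sine is positive for `0 < x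
< 1/2`. -/
lemma eq_zero_of_norm_maskFun_eq_one {x : ℝ} (h0 : 0 ≤ x) (h1 : x < 1 / 2)
    (h : ‖maskFun cantorB x‖ = 1) : x = 0 := by
  have hc := normSq_maskFun_cantorB x
  rw [h] at hc
  have hs : Real.sin (2 * Real.pi * x) = 0 := by
    have := Real.sin_sq_add_cos_sq (2 * Real.pi * x)
    nlinarith
  by_contra hx
  have hx0 : 0 < x := lt_of_le_of_ne h0 (Ne.symm hx)
  have hp := Real.pi_pos
  have := Real.sin_pos_of_pos_of_lt_pi (x := 2 * Real.pi * x) (by positivity) (by nlinarith)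
  linarith

lemma IsExtremeCycleSeq.eq_zero {p : ℕ} {c : ℕ → ℝ}
    (h : IsExtremeCycleSeq 3 cantorB cantorL p c) : ∀ i < p, c i = 0 := by
  obtain ⟨hp, hper, h⟩ := h
  have hne : (Finset.range p).Nonempty := ⟨0, Finset.mem_range.2 hp⟩
  -- Every cycle point has a predecessor; for index `0` it is `p - 1`, by periodicity.
  have hpred : ∀ i < p, ∃ j < p, ∃ l ∈ cantorL, c i = (c j + l) / 3 := by
    intro i hi
    rcases Nat.eq_zero_or_pos i with rfl | hi0
    · obtain ⟨l, hl, e⟩ := (h (p - 1) (by omega)).1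
      rw [Nat.sub_add_cancel hp, hper] at e
      exact ⟨p - 1, by omega, l, hl, e⟩
    · obtain ⟨l, hl, e⟩ := (h (i - 1) (by omega)).1
      rw [Nat.sub_add_cancel hi0] at e
      exact ⟨i - 1, by omega, l, hl, e⟩
  -- A minimal point `m` satisfies `m ≥ m / 3`. Dually, a maximal point `M` satisfies `M ≤ (M + 3/4)
  -- / 3`, which gives the bound `3/8` below.
  have hlb : ∀ i < p, 0 ≤ c i := by
    obtain ⟨k, hk, hmin⟩ := Finset.exists_min_image (Finset.range p) c hne
    obtain ⟨j, hj, l, hl, e⟩ := hpred k (Finset.mem_range.1 hk)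
    have h1 := hmin j (Finset.mem_range.2 hj)
    have h2 : 0 ≤ l := by rcases mem_cantorL.1 hl with rfl | rfl <;> norm_num
    intro i hi
    have := hmin i (Finset.mem_range.2 hi)
    linarith
  have hub : ∀ i < p, c i ≤ 3 / 8 := by
    obtain ⟨k, hk, hmax⟩ := Finset.exists_max_image (Finset.range p) c hne
    obtain ⟨j, hj, l, hl, e⟩ := hpred k (Finset.mem_range.1 hk)
    have h1 := hmax j (Finset.mem_range.2 hj)
    have h2 : l ≤ 3 / 4 := by rcases mem_cantorL.1 hl with rfl | rfl <;> norm_num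
    intro i hi
    have := hmax i (Finset.mem_range.2 hi)
    linarith
  intro i hi
  exact eq_zero_of_norm_maskFun_eq_one (hlb i hi) (by linarith [hub i hi]) (h i hi).2

lemma isExtremeCycleSeq_zero : IsExtremeCycleSeq 3 cantorB cantorL 1 (fun _ => 0) :=
  ⟨one_pos, rfl, fun _ _ => ⟨⟨0, by simp [cantorL], by simp⟩, norm_maskFun_zero⟩⟩

theorem isExtremeCyclePoint_iff (c : ℝ) :
    IsExtremeCyclePoint 3 cantorB cantorL c ↔ c = 0 := by
  constructor
  · rintro ⟨p, s, hs, rfl⟩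
    exact hs.eq_zero 0 hs.1
  · rintro rfl
    exact ⟨1, _, isExtremeCycleSeq_zero, rfl⟩

theorem isExtremeCycle_iff (C : Set ℝ) :
    IsExtremeCycle 3 cantorB cantorL C ↔ C = {0} := by
  constructor
  · rintro ⟨p, s, hs, rfl⟩
    ext x
    constructor
    · rintro ⟨i, hi, rfl⟩
      exact hs.eq_zero i hi
    · rintro rfl
      exact ⟨0, hs.1, hs.eq_zero 0 hs.1⟩
  · rintro rfl
    refine ⟨1, _, isExtremeCycleSeq_zero, ?_⟩
    ext x
    constructor
    · rintro rfl
      exact ⟨0, Nat.one_pos, rfl⟩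
    · rintro ⟨i, hi, rfl⟩
      rfl

/-! ### Phases and frequencies -/

lemma freq_succ {n : ℕ} (l : Fin (n + 1) → ℝ) :
    freq 3 l = l 0 + 3 * freq 3 (fun k => l k.succ) := by
  simp only [freq, Fin.sum_univ_succ, Finset.mul_sum]
  simp [pow_succ', mul_assoc]

/-- The first digit contributes `3 ^ k * b 0` to the coefficient of the letter at position `k + 1`;
these terms sum to `b 0` times the frequency of the remaining letters. -/
lemma phase_succ {n : ℕ} (b l : Fin (n + 1) → ℝ) :
    phase 3 b l = phase 3 (fun k => b k.succ) (fun k => l k.succ)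
      - b 0 * freq 3 (fun k => l k.succ) := by
  have h : ∀ k : Fin n,
      ∑ j ∈ Finset.univ.filter (fun j : Fin (n + 1) => j < k.succ),
        (3 : ℝ) ^ (((k.succ : Fin (n + 1)) : ℕ) - 1 - (j : ℕ)) * b j =
      3 ^ (k : ℕ) * b 0 + ∑ j ∈ Finset.univ.filter (fun j : Fin n => j < k),
        (3 : ℝ) ^ ((k : ℕ) - 1 - (j : ℕ)) * b j.succ := by
    intro k
    rw [Finset.sum_filter, Finset.sum_filter, Fin.sum_univ_succ]
    congr 1
    refine Finset.sum_congr rfl fun j _ => ?_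
    simp only [Fin.succ_lt_succ_iff, Fin.val_succ]
    -- The exponents agree even where the natural subtraction truncates, so the condition `j < k` is
    -- not needed.
    rw [Nat.add_sub_cancel, Nat.sub_sub, add_comm 1]
  rw [phase, Fin.sum_univ_succ]
  simp only [h, Fin.not_lt_zero, Finset.filter_false, Finset.sum_empty, zero_mul, zero_add]
  simp only [phase, freq, add_mul, Finset.sum_add_distrib, Finset.mul_sum]
  rw [neg_add, sub_eq_add_neg, add_comm]
  congr 2
  exact Finset.sum_congr rfl fun k _ => by ring

lemma exists_freq_eq {n : ℕ} (l : Fin n → cantorL) :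
    ∃ m : ℤ, freq 3 (fun k => (l k : ℝ)) = 3 / 4 * m := by
  induction n with
  | zero => exact ⟨0, by simp [freq]⟩
  | succ n ih =>
    obtain ⟨m, hm⟩ := ih fun k => l k.succ
    rw [freq_succ, hm]
    rcases mem_cantorL.1 (l 0).2 with h | h
    · exact ⟨3 * m, by rw [h]; push_cast; ring⟩
    · exact ⟨3 * m + 1, by rw [h]; push_cast; ring⟩

lemma exists_phase_eq {n : ℕ} (b : Fin n → cantorB) (l : Fin n → cantorL) :
    ∃ m : ℤ, phase 3 (fun k => (b k : ℝ)) (fun k => (l k : ℝ)) = m / 2 := by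
  induction n with
  | zero => exact ⟨0, by simp [phase]⟩
  | succ n ih =>
    obtain ⟨m, hm⟩ := ih (fun k => b k.succ) fun k => l k.succ
    obtain ⟨q, hq⟩ := exists_freq_eq fun k => l k.succ
    rw [phase_succ, hm, hq]
    rcases mem_cantorB.1 (b 0).2 with h | h
    · exact ⟨m, by rw [h]; ring⟩
    -- The correction is `2 * (3/4 * q) = 3 * q / 2`, again a half-integer.
    · exact ⟨m - 3 * q, by rw [h]; push_cast; ring⟩

theorem expFun_phase_mem {n : ℕ} (b : Fin n → cantorB) (l : Fin n → cantorL) :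
    expFun (phase 3 (fun k => (b k : ℝ)) (fun k => (l k : ℝ))) 1 ∈ ({1, -1} : Set ℂ) := by
  obtain ⟨m, hm⟩ := exists_phase_eq b l
  exact expFun_half_int m (by rw [hm, mul_one])

/-! ### The invariant measure -/

lemma continuous_tau (b : ℝ) : Continuous (tau 3 b) := by
  unfold tau; fun_prop

lemma tau_injective (b : ℝ) : Function.Injective (tau 3 b) := by
  intro x y h
  simp only [tau] at h
  linarith

lemma measurableEmbedding_tau (b : ℝ) : MeasurableEmbedding (tau 3 b) :=
  (continuous_tau b).measurableEmbedding (tau_injective b)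

namespace IsInvariantMeasure

variable {μ : Measure ℝ} [IsProbabilityMeasure μ]

/-- Finite measures on the line are determined by their integrals of compactly supported continuous
functions. Doubling avoids the scalar `1/2` on measures. -/
lemma add_self_eq (h : IsInvariantMeasure 3 cantorB μ) :
    μ + μ = μ.map (tau 3 0) + μ.map (tau 3 2) := by
  have hp : ∀ b, IsProbabilityMeasure (μ.map (tau 3 b)) := fun b =>
    Measure.isProbabilityMeasure_map (continuous_tau b).measurable.aemeasurable
  have h0 := hp 0
  have h2 := hp 2
  refine Measure.ext_of_integral_eq_on_compactlySupported fun f => ?_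
  have hi : ∀ ν : Measure ℝ, IsProbabilityMeasure ν → Integrable f ν := fun ν _ =>
    f.continuous.integrable_of_hasCompactSupport f.hasCompactSupport
  have hf := h f f.continuous f.hasCompactSupport
  rw [sum_cantorB, card_cantorB] at hf
  rw [integral_add_measure (hi _ inferInstance) (hi _ inferInstance),
    integral_add_measure (hi _ h0) (hi _ h2), (measurableEmbedding_tau 0).integral_map,
    (measurableEmbedding_tau 2).integral_map]
  push_cast at hf
  linarith

lemma ae_of_tau (h : IsInvariantMeasure 3 cantorB μ) {p : ℝ → Prop}
    (hp : ∀ b ∈ cantorB, ∀ᵐ x ∂μ, p (tau 3 b x)) : ∀ᵐ x ∂μ, p x := by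
  have : ∀ᵐ x ∂(μ + μ), p x := by
    rw [h.add_self_eq, ae_add_measure_iff, (measurableEmbedding_tau 0).ae_map_iff,
      (measurableEmbedding_tau 2).ae_map_iff]
    exact ⟨hp 0 (by simp [cantorB]), hp 2 (by simp [cantorB])⟩
  exact (ae_add_measure_iff.1 this).1

lemma measure_add_self (h : IsInvariantMeasure 3 cantorB μ) {s : Set ℝ} (hs : MeasurableSet s) :
    μ s + μ s = μ (tau 3 0 ⁻¹' s) + μ (tau 3 2 ⁻¹' s) := by
  have := congrArg (fun ν : Measure ℝ => ν s) h.add_self_eq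
  simpa [Measure.map_apply (continuous_tau _).measurable hs] using this

/-- Both branches fix the position of `[0, 1]` and shrink a margin `3 * t` around it to at most `t`.
Iterated outwards, this gives each margin `t > 0` the mass of the whole line. -/
lemma measure_Icc_le (h : IsInvariantMeasure 3 cantorB μ) (t : ℝ) :
    μ (Set.Icc (-(3 * t)) (1 + 3 * t)) ≤ μ (Set.Icc (-t) (1 + t)) := by
  have e := h.measure_add_self (measurableSet_Icc (a := -t) (b := 1 + t))
  have hsub : ∀ b ∈ cantorB,
      μ (Set.Icc (-(3 * t)) (1 + 3 * t)) ≤ μ (tau 3 b ⁻¹' Set.Icc (-t) (1 + t)) := by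
    intro b hb
    refine measure_mono fun x hx => ?_
    simp only [Set.mem_Icc, Set.mem_preimage, tau] at *
    rcases mem_cantorB.1 hb with rfl | rfl <;> constructor <;> linarith
  have h2 : 2 * μ (Set.Icc (-(3 * t)) (1 + 3 * t)) ≤ 2 * μ (Set.Icc (-t) (1 + t)) := by
    rw [two_mul, two_mul, e]
    exact add_le_add (hsub 0 (by simp [cantorB])) (hsub 2 (by simp [cantorB]))
  exact (ENNReal.mul_le_mul_iff_right (by norm_num) (by norm_num)).1 h2

lemma ae_mem_Icc_of_pos (h : IsInvariantMeasure 3 cantorB μ) {t : ℝ} (ht : 0 < t) :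
    ∀ᵐ x ∂μ, x ∈ Set.Icc (-t) (1 + t) := by
  have hle : ∀ n : ℕ, μ (Set.Icc (-(3 ^ n * t)) (1 + 3 ^ n * t)) ≤ μ (Set.Icc (-t) (1 + t)) := by
    intro n
    induction n with
    | zero => simp
    | succ n ih =>
      refine le_trans ?_ ih
      have := h.measure_Icc_le (3 ^ n * t)
      rwa [← mul_assoc, ← pow_succ'] at this
  have hmono : Monotone fun n : ℕ => Set.Icc (-(3 ^ n * t)) (1 + 3 ^ n * t) := by
    intro m n hmn
    have : (3 : ℝ) ^ m * t ≤ 3 ^ n * t := by gcongr; norm_num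
    exact Set.Icc_subset_Icc (by linarith) (by linarith)
  have huniv : ⋃ n : ℕ, Set.Icc (-(3 ^ n * t)) (1 + 3 ^ n * t) = Set.univ := by
    refine Set.eq_univ_of_forall fun x => Set.mem_iUnion.2 ?_
    obtain ⟨n, hn⟩ := pow_unbounded_of_one_lt (|x| / t) (by norm_num : (1 : ℝ) < 3)
    rw [div_lt_iff₀ ht] at hn
    have := abs_le.1 hn.le
    exact ⟨n, by constructor <;> linarith⟩
  have h1 : 1 ≤ μ (Set.Icc (-t) (1 + t)) := by
    rw [← measure_univ (μ := μ), ← huniv, hmono.measure_iUnion]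
    exact iSup_le hle
  exact (mem_ae_iff_prob_eq_one measurableSet_Icc).2 (le_antisymm prob_le_one h1)

lemma ae_mem_Icc (h : IsInvariantMeasure 3 cantorB μ) : ∀ᵐ x ∂μ, x ∈ Set.Icc (0 : ℝ) 1 := by
  have hn : ∀ᵐ x ∂μ, ∀ n : ℕ, x ∈ Set.Icc (-(1 / ((n : ℝ) + 1))) (1 + 1 / ((n : ℝ) + 1)) :=
    ae_all_iff.2 fun n => h.ae_mem_Icc_of_pos Nat.one_div_pos_of_nat
  filter_upwards [hn] with x hx
  have key : ∀ y : ℝ, (∀ n : ℕ, y ≤ 1 / ((n : ℝ) + 1)) → y ≤ 0 := by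
    intro y hy
    by_contra! hpos
    obtain ⟨n, hn⟩ := exists_nat_one_div_lt hpos
    exact absurd (hy n) (not_le.2 hn)
  constructor
  · have := key (-x) fun n => by linarith [(hx n).1]
    linarith
  · have := key (x - 1) fun n => by linarith [(hx n).2]
    linarith

/-- Starting from `[0, 1]`, self-similarity carries full measure from each stage of the Cantor
construction to the next. -/
lemma ae_mem_cantorSet (h : IsInvariantMeasure 3 cantorB μ) : ∀ᵐ x ∂μ, x ∈ cantorSet := by
  have hn : ∀ n, ∀ᵐ x ∂μ, x ∈ preCantorSet n := by
    intro n
    induction n with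
    | zero => exact h.ae_mem_Icc
    | succ n ih =>
      refine h.ae_of_tau fun b hb => ?_
      filter_upwards [ih] with x hx
      rw [preCantorSet_succ]
      rcases mem_cantorB.1 hb with rfl | rfl
      · exact Or.inl ⟨x, hx, by simp only [tau]; ring⟩
      · exact Or.inr ⟨x, hx, by simp only [tau]; ring⟩
  simpa [cantorSet] using ae_all_iff.2 hn

end IsInvariantMeasure

/-! ### Absence of overlap and invariance under the shift -/

theorem noOverlap_cantorB (μ : Measure ℝ) : NoOverlap 3 cantorB μ := by
  intro b hb b' hb' hne
  rw [attractor_cantorB]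
  convert measure_empty (μ := μ)
  ext z
  constructor
  · rintro ⟨⟨x, hx, rfl⟩, y, hy, hxy⟩
    exact hne (digit_eq_of_tau_eq hb' hb hy hx hxy).symm
  · exact fun hz => hz.elim

lemma measurable_shiftMap : Measurable (shiftMap 3 cantorB) := by
  classical
  have hm : ∀ b, MeasurableSet (tau 3 b '' cantorSet) := fun b =>
    (isCompact_cantorSet.image (continuous_tau b)).isClosed.measurableSet
  have heq : shiftMap 3 cantorB = fun x => if x ∈ tau 3 0 '' cantorSet then 3 * x else
      if x ∈ tau 3 2 '' cantorSet then 3 * x - 2 else 0 := by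
    funext x
    split_ifs with h0 h2
    · obtain ⟨y, hy, rfl⟩ := h0
      rw [shiftMap_tau (by simp [cantorB]) hy]
      simp only [tau]; ring
    · obtain ⟨y, hy, rfl⟩ := h2
      rw [shiftMap_tau (by simp [cantorB]) hy]
      simp only [tau]; ring
    · rw [shiftMap, dif_neg]
      rintro ⟨b, hb, hx⟩
      rw [attractor_cantorB] at hx
      rcases mem_cantorB.1 hb with rfl | rfl
      · exact h0 hx
      · exact h2 hx
  rw [heq]
  exact Measurable.ite (hm 0) (by fun_prop) (Measurable.ite (hm 2) (by fun_prop) (by fun_prop))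

namespace IsInvariantMeasure

variable {μ : Measure ℝ} [IsProbabilityMeasure μ]

/-- The shift inverts each branch almost everywhere, so pushing `add_self_eq` forward by it turns
the right side into `μ + μ`. -/
theorem measurePreserving_shiftMap (h : IsInvariantMeasure 3 cantorB μ) :
    MeasurePreserving (shiftMap 3 cantorB) μ μ := by
  refine ⟨measurable_shiftMap, ?_⟩
  have hb : ∀ b ∈ cantorB, (μ.map (tau 3 b)).map (shiftMap 3 cantorB) = μ := by
    intro b hb
    rw [Measure.map_map measurable_shiftMap (continuous_tau b).measurable]
    conv_rhs => rw [← Measure.map_id (μ := μ)]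
    refine Measure.map_congr ?_
    filter_upwards [h.ae_mem_cantorSet] with x hx
    exact shiftMap_tau hb hx
  have h2 := congrArg (Measure.map (shiftMap 3 cantorB)) h.add_self_eq
  rw [Measure.map_add _ _ measurable_shiftMap, Measure.map_add _ _ measurable_shiftMap,
    hb 0 (by simp [cantorB]), hb 2 (by simp [cantorB])] at h2
  ext s hs
  have h3 := congrArg (fun ν : Measure ℝ => ν s) h2
  simp only [Measure.add_apply, ← two_mul] at h3
  exact (ENNReal.mul_right_inj (by norm_num) (by norm_num)).1 h3

lemma integral_add_self (h : IsInvariantMeasure 3 cantorB μ) {G : ℝ → ℂ} (hG : Integrable G μ) :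
    (∫ x, G x ∂μ) + ∫ x, G x ∂μ = (∫ x, G (tau 3 0 x) ∂μ) + ∫ x, G (tau 3 2 x) ∂μ := by
  have hG2 : Integrable G (μ.map (tau 3 0) + μ.map (tau 3 2)) := by
    rw [← h.add_self_eq]
    exact hG.add_measure hG
  rw [← integral_add_measure hG hG, h.add_self_eq,
    integral_add_measure hG2.left_of_add_measure hG2.right_of_add_measure,
    (measurableEmbedding_tau 0).integral_map, (measurableEmbedding_tau 2).integral_map]

lemma integral_expFun_mul_comp_shiftMap (h : IsInvariantMeasure 3 cantorB μ) {s : ℝ}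
    (hs : s = 3 / 4 ∨ s = -(3 / 4)) {F : ℝ → ℂ} (hF : Integrable F μ) :
    ∫ x, expFun s x * F (shiftMap 3 cantorB x) ∂μ = 0 := by
  have hFr : Integrable (fun x => F (shiftMap 3 cantorB x)) μ :=
    h.measurePreserving_shiftMap.integrable_comp_of_integrable hF
  have hG : Integrable (fun x => expFun s x * F (shiftMap 3 cantorB x)) μ :=
    hFr.bdd_mul (c := 1) (continuous_expFun s).aestronglyMeasurable
      (Filter.Eventually.of_forall fun x => (norm_expFun s x).le)
  have e := h.integral_add_self hG
  -- The branches differ by `2/3`, where `expFun s` equals `-1`, while the shift returns the same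
  -- `x` on both.
  have e2 : ∫ x, expFun s (tau 3 2 x) * F (shiftMap 3 cantorB (tau 3 2 x)) ∂μ =
      -∫ x, expFun s (tau 3 0 x) * F (shiftMap 3 cantorB (tau 3 0 x)) ∂μ := by
    rw [← integral_neg]
    refine integral_congr_ae ?_
    filter_upwards [h.ae_mem_cantorSet] with x hx
    rw [shiftMap_tau (by simp [cantorB]) hx, shiftMap_tau (by simp [cantorB]) hx]
    have hx2 : tau 3 2 x = tau 3 0 x + 2 / 3 := by simp only [tau]; ring
    have hh : expFun s (2 / 3) = -1 := by
      rcases hs with rfl | rfl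
      · exact expFun_half (by norm_num)
      · exact expFun_neg_half (by norm_num)
    rw [hx2, expFun_add_right, hh]
    ring
  rw [e2, add_neg_cancel] at e
  exact self_eq_neg.1 (eq_neg_of_add_eq_zero_left e)

end IsInvariantMeasure

/-! ### Completeness of the exponential functions -/

lemma integrable_expFun_mul {μ : Measure ℝ} (t : ℝ) {F : ℝ → ℂ} (hF : Integrable F μ) :
    Integrable (fun x => expFun t x * F x) μ :=
  hF.bdd_mul (c := 1) (continuous_expFun t).aestronglyMeasurable
    (Filter.Eventually.of_forall fun x => (norm_expFun t x).le)

/-- The positive and negative parts of `g` are densities of two finite measures with the same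
characteristic function, so these measures coincide. Since the parts are never both nonzero at a
point, both vanish. -/
lemma ae_eq_zero_of_integral_expFun_mul_ofReal {μ : Measure ℝ} {g : ℝ → ℝ} (hg : Integrable g μ)
    (h : ∀ t, ∫ x, expFun t x * (g x : ℂ) ∂μ = 0) : g =ᵐ[μ] 0 := by
  have hfin : ∀ k : ℝ → ℝ, Integrable k μ →
      IsFiniteMeasure (μ.withDensity fun x => ENNReal.ofReal (k x)) := fun k hk =>
    isFiniteMeasure_withDensity_ofReal hk.2
  have h1 := hfin g hg
  have h2 := hfin (fun x => -g x) hg.neg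
  have hm1 : AEMeasurable (fun x => ENNReal.ofReal (g x)) μ := hg.aemeasurable.ennreal_ofReal
  have hm2 : AEMeasurable (fun x => ENNReal.ofReal (-g x)) μ := hg.neg.aemeasurable.ennreal_ofReal
  have hpart : ∀ k : ℝ → ℝ, Integrable k μ → ∀ t : ℝ,
      charFun (μ.withDensity fun x => ENNReal.ofReal (k x)) t =
      ∫ x, expFun (t / (2 * Real.pi)) x * ((max (k x) 0 : ℝ) : ℂ) ∂μ := by
    intro k hk t
    rw [charFun_apply_real, integral_withDensity_eq_integral_toReal_smul₀
      hk.aemeasurable.ennreal_ofReal (Filter.Eventually.of_forall fun _ => ENNReal.ofReal_lt_top)]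
    refine integral_congr_ae (Filter.Eventually.of_forall fun x => ?_)
    have hpi : (Real.pi : ℂ) ≠ 0 := by exact_mod_cast Real.pi_ne_zero
    have he : Complex.exp (t * x * Complex.I) = expFun (t / (2 * Real.pi)) x := by
      rw [expFun]
      congr 1
      push_cast
      field_simp
    simp only [ENNReal.toReal_ofReal', Complex.real_smul, he]
    rw [mul_comm]
  have hmeas : (μ.withDensity fun x => ENNReal.ofReal (g x)) =
      μ.withDensity fun x => ENNReal.ofReal (-g x) := by
    refine Measure.ext_of_charFun (funext fun t => ?_)
    rw [hpart g hg, hpart (fun x => -g x) hg.neg, ← sub_eq_zero, ← integral_sub]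
    · rw [← h (t / (2 * Real.pi))]
      refine integral_congr_ae (Filter.Eventually.of_forall fun x => ?_)
      have : g x = max (g x) 0 - max (-g x) 0 := by
        rcases le_total (g x) 0 with hx | hx
        · rw [max_eq_right hx, max_eq_left (by linarith)]; ring
        · rw [max_eq_left hx, max_eq_right (by linarith)]; ring
      have hc : (g x : ℂ) = (max (g x) 0 : ℝ) - (max (-g x) 0 : ℝ) := by exact_mod_cast this
      linear_combination -expFun (t / (2 * Real.pi)) x * hc
    · exact integrable_expFun_mul _ hg.pos_part.ofReal
    · exact integrable_expFun_mul _ hg.neg_part.ofReal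
  have hfi : ∫⁻ x, ENNReal.ofReal (g x) ∂μ ≠ ⊤ := by
    have := measure_ne_top (μ.withDensity fun x => ENNReal.ofReal (g x)) Set.univ
    rwa [withDensity_apply _ MeasurableSet.univ, Measure.restrict_univ] at this
  filter_upwards [(withDensity_eq_iff hm1 hm2 hfi).1 hmeas] with x hx
  have := congrArg ENNReal.toReal hx
  simp only [ENNReal.toReal_ofReal'] at this
  rcases le_total (g x) 0 with h0 | h0
  · rw [max_eq_right h0, max_eq_left (by linarith)] at this
    simp only [Pi.zero_apply]; linarith
  · rw [max_eq_left h0, max_eq_right (by linarith)] at this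
    simpa using this

/-- The hypothesis is stable under conjugating `F`, as all frequencies of both signs are allowed;
the real and imaginary parts can thus be treated separately. -/
lemma ae_eq_zero_of_integral_expFun_mul {μ : Measure ℝ} {F : ℝ → ℂ} (hF : Integrable F μ)
    (h : ∀ t, ∫ x, expFun t x * F x ∂μ = 0) : F =ᵐ[μ] 0 := by
  have hc : ∀ t, ∫ x, expFun t x * (starRingEnd ℂ) (F x) ∂μ = 0 := by
    intro t
    have := congrArg (starRingEnd ℂ) (h (-t))
    rw [← integral_conj] at this
    simpa [star_expFun] using this
  have hFc : Integrable (fun x => (starRingEnd ℂ) (F x)) μ :=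
    (Complex.conjCLE : ℂ →L[ℝ] ℂ).integrable_comp hF
  have hre : (fun x => (F x).re) =ᵐ[μ] 0 := by
    refine ae_eq_zero_of_integral_expFun_mul_ofReal hF.re fun t => ?_
    have : ∀ x, expFun t x * ((F x).re : ℂ) =
        2⁻¹ * (expFun t x * F x + expFun t x * (starRingEnd ℂ) (F x)) := by
      intro x
      rw [Complex.re_eq_add_conj]; ring
    simp only [this]
    rw [integral_const_mul, integral_add (integrable_expFun_mul t hF) (integrable_expFun_mul t hFc),
      h, hc]
    simp
  have him : (fun x => (F x).im) =ᵐ[μ] 0 := by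
    refine ae_eq_zero_of_integral_expFun_mul_ofReal hF.im fun t => ?_
    have : ∀ x, expFun t x * ((F x).im : ℂ) =
        (2 * Complex.I)⁻¹ * (expFun t x * F x - expFun t x * (starRingEnd ℂ) (F x)) := by
      intro x
      rw [Complex.im_eq_sub_conj]; ring
    simp only [this]
    rw [integral_const_mul, integral_sub (integrable_expFun_mul t hF) (integrable_expFun_mul t hFc),
      h, hc]
    simp
  filter_upwards [hre, him] with x h1 h2
  exact Complex.ext h1 h2

/-! ### A functional equation -/

/-- A nonnegative continuous solution of the averaging equation for the dual iterated function
system that vanishes at the only extreme cycle point vanishes identically. -/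
lemma eq_zero_of_averaging {u : ℝ → ℝ} (hc : Continuous u) (h0 : u 0 = 0) (hpos : ∀ t, 0 ≤ u t)
    (hu : ∀ t, u t = Real.cos (2 * Real.pi * (t / 3)) ^ 2 * u (t / 3) +
      Real.sin (2 * Real.pi * (t / 3)) ^ 2 * u ((t - 3 / 4) / 3)) (t : ℝ) : u t = 0 := by
  -- The interval `[-3/8, 0]` is mapped into itself by `t ↦ t / 3` and `t ↦ (t - 3/4) / 3`.
  have hI : ∀ t ∈ Set.Icc (-(3 / 8) : ℝ) 0, u t = 0 := by
    obtain ⟨t₀, ht₀, hmax⟩ := isCompact_Icc.exists_isMaxOn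
      (Set.nonempty_Icc.2 (by norm_num : (-(3 / 8) : ℝ) ≤ 0)) hc.continuousOn
    have hmax' : ∀ t ∈ Set.Icc (-(3 / 8) : ℝ) 0, u t ≤ u t₀ := fun t ht => hmax ht
    -- On this interval `2πt/3` lies in `[-π/4, 0]`, so the cosine weight is positive, and a maximal
    -- value must be shared by `u (t / 3)`. Iteration carries the maximum to the point `0`.
    have hstep : ∀ t ∈ Set.Icc (-(3 / 8) : ℝ) 0, u t = u t₀ → u (t / 3) = u t₀ := by
      intro t ht hM
      have ha := hmax' (t / 3) ⟨by linarith [ht.1], by linarith [ht.2]⟩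
      have hb := hmax' ((t - 3 / 4) / 3) ⟨by linarith [ht.1], by linarith [ht.2]⟩
      have hcos : 0 < Real.cos (2 * Real.pi * (t / 3)) := by
        have hp := Real.pi_pos
        refine Real.cos_pos_of_mem_Ioo ⟨?_, ?_⟩ <;> nlinarith [ht.1, ht.2]
      have hcs := Real.sin_sq_add_cos_sq (2 * Real.pi * (t / 3))
      have e := hu t
      rw [hM] at e
      refine le_antisymm ha ?_
      have h1 : Real.cos (2 * Real.pi * (t / 3)) ^ 2 * (u t₀ - u (t / 3)) ≤ 0 := by
        have h2 := mul_nonneg (sq_nonneg (Real.sin (2 * Real.pi * (t / 3)))) (sub_nonneg.2 hb)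
        have h3 : u t₀ = (Real.sin (2 * Real.pi * (t / 3)) ^ 2 +
          Real.cos (2 * Real.pi * (t / 3)) ^ 2) * u t₀ := by rw [hcs, one_mul]
        linarith
      have := nonpos_of_mul_nonpos_right h1 (by positivity)
      linarith
    have hiter : ∀ n : ℕ, t₀ / 3 ^ n ∈ Set.Icc (-(3 / 8) : ℝ) 0 ∧ u (t₀ / 3 ^ n) = u t₀ := by
      intro n
      induction n with
      | zero => simpa using ht₀
      | succ n ih =>
        obtain ⟨hm, he⟩ := ih
        have := hstep _ hm he
        rw [pow_succ, ← div_div]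
        exact ⟨⟨by linarith [hm.1], by linarith [hm.2]⟩, this⟩
    have hlim : Filter.Tendsto (fun n : ℕ => t₀ / 3 ^ n) Filter.atTop (nhds 0) :=
      tendsto_const_nhds.div_atTop (tendsto_pow_atTop_atTop_of_one_lt (by norm_num))
    have hM : u t₀ = 0 := by
      have h1 := (hc.tendsto 0).comp hlim
      rw [h0] at h1
      have h2 : (u ∘ fun n : ℕ => t₀ / 3 ^ n) = fun _ => u t₀ := funext fun n => (hiter n).2
      rw [h2] at h1
      exact tendsto_nhds_unique tendsto_const_nhds h1
    intro t ht
    exact le_antisymm (hM ▸ hmax' t ht) (hpos t)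
  refine le_antisymm (le_of_forall_pos_le_add fun ε hε => ?_) (hpos t)
  rw [zero_add]
  obtain ⟨δ, hδ, hδI⟩ : ∃ δ > 0, ∀ t ∈ Set.Icc (-(3 / 8) - δ) δ, u t ≤ ε := by
    have hl := hI (-(3 / 8)) ⟨le_rfl, by norm_num⟩
    obtain ⟨δ₁, h1, h1'⟩ := Metric.continuous_iff.1 hc 0 ε hε
    obtain ⟨δ₂, h2, h2'⟩ := Metric.continuous_iff.1 hc (-(3 / 8)) ε hε
    refine ⟨min δ₁ δ₂ / 2, by positivity, fun t ht => ?_⟩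
    have hm1 := min_le_left δ₁ δ₂
    have hm2 := min_le_right δ₁ δ₂
    have hm : 0 < min δ₁ δ₂ := lt_min h1 h2
    rcases le_or_gt t 0 with ht0 | ht0
    · rcases le_or_gt (-(3 / 8)) t with htl | htl
      · rw [hI t ⟨htl, ht0⟩]; exact hε.le
      · have := h2' t (by rw [Real.dist_eq, abs_lt]; constructor <;> linarith [ht.1])
        rw [hl, Real.dist_eq, sub_zero] at this
        exact (le_abs_self _).trans this.le
    · have := h1' t (by rw [Real.dist_eq, abs_lt]; constructor <;> linarith [ht.2])
      rw [h0, Real.dist_eq, sub_zero] at this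
      exact (le_abs_self _).trans this.le
  -- Both maps divide the margin around `[-3/8, 0]` by at least three, so a bound by `ε` on a small
  -- margin spreads to all of the line.
  have hgrow : ∀ n : ℕ, ∀ t ∈ Set.Icc (-(3 / 8) - 3 ^ n * δ) (3 ^ n * δ), u t ≤ ε := by
    intro n
    induction n with
    | zero => simpa using hδI
    | succ n ih =>
      intro t ht
      rw [pow_succ'] at ht
      have hD : 0 < (3 : ℝ) ^ n * δ := by positivity
      have ha := ih (t / 3) ⟨by linarith [ht.1], by linarith [ht.2]⟩
      have hb := ih ((t - 3 / 4) / 3) ⟨by linarith [ht.1], by linarith [ht.2]⟩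
      have hcs := Real.sin_sq_add_cos_sq (2 * Real.pi * (t / 3))
      rw [hu t]
      calc _ ≤ Real.cos (2 * Real.pi * (t / 3)) ^ 2 * ε +
            Real.sin (2 * Real.pi * (t / 3)) ^ 2 * ε := by gcongr
        _ = ε := by rw [← add_mul, add_comm, hcs, one_mul]
  obtain ⟨n, hn⟩ := pow_unbounded_of_one_lt (|t| / δ) (by norm_num : (1 : ℝ) < 3)
  rw [div_lt_iff₀ hδ] at hn
  have := abs_le.1 hn.le
  exact hgrow n t ⟨by linarith, this.2⟩

/-! ### The Cuntz isometries on exponential functions -/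

section Cuntz

variable {μ : Measure ℝ}

lemma coeFn_cuntzOp {r : ℝ → ℝ} (hr : MeasurePreserving r μ μ) (l : ℝ) (f : Lp ℂ 2 μ) :
    cuntzOp hr l f =ᵐ[μ] fun x => expFun l x * f (r x) :=
  MemLp.coeFn_toLp (memLp_cuntz hr l f)

lemma cuntzWord_nil {r : ℝ → ℝ} (hr : MeasurePreserving r μ μ) {L : Finset ℝ} (f : Lp ℂ 2 μ) :
    cuntzWord hr ([] : List L) f = f := rfl

lemma cuntzWord_cons {r : ℝ → ℝ} (hr : MeasurePreserving r μ μ) {L : Finset ℝ} (l : L)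
    (w : List L) (f : Lp ℂ 2 μ) :
    cuntzWord hr (l :: w) f = cuntzOp hr l (cuntzWord hr w f) := rfl

variable [IsProbabilityMeasure μ]

lemma memLp_expFun (t : ℝ) : MemLp (expFun t) 2 μ :=
  MemLp.of_bound (continuous_expFun t).aestronglyMeasurable 1
    (Filter.Eventually.of_forall fun x => (norm_expFun t x).le)

/-- The exponential function `e_t` as an element of `L²(μ)`. -/
noncomputable def expLp (μ : Measure ℝ) [IsProbabilityMeasure μ] (t : ℝ) : Lp ℂ 2 μ :=
  (memLp_expFun t).toLp (expFun t)

lemma coeFn_expLp (t : ℝ) : expLp μ t =ᵐ[μ] expFun t := MemLp.coeFn_toLp _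

lemma expLp_zero : expLp μ 0 = Lp.const 2 μ (1 : ℂ) := by
  refine Lp.ext ?_
  filter_upwards [coeFn_expLp (μ := μ) 0, Lp.coeFn_const (p := 2) (μ := μ) (1 : ℂ)] with x h1 h2
  rw [h1, h2, expFun_zero_left, Function.const_apply]

lemma cuntzOp_zero_const {r : ℝ → ℝ} (hr : MeasurePreserving r μ μ) :
    cuntzOp hr 0 (Lp.const 2 μ (1 : ℂ)) = Lp.const 2 μ (1 : ℂ) := by
  refine Lp.ext ?_
  have hc := Lp.coeFn_const (p := 2) (μ := μ) (1 : ℂ)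
  filter_upwards [coeFn_cuntzOp hr 0 (Lp.const 2 μ (1 : ℂ)), hc,
    hr.quasiMeasurePreserving.ae hc] with x h1 h2 h3
  rw [h1, h2, h3, expFun_zero_left, one_mul, Function.const_apply, Function.const_apply]

lemma norm_cuntzWord_const {r : ℝ → ℝ} (hr : MeasurePreserving r μ μ) {L : Finset ℝ}
    (w : List L) : ‖cuntzWord hr w (Lp.const 2 μ (1 : ℂ))‖ = 1 := by
  induction w with
  | nil =>
    rw [cuntzWord_nil, Lp.norm_const' _ _ _ two_ne_zero ENNReal.ofNat_ne_top]
    simp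
  | cons l w ih => rw [cuntzWord_cons, LinearIsometry.norm_map, ih]

lemma norm_expFun_sub_le (s t x : ℝ) :
    ‖expFun s x - expFun t x‖ ≤ 2 * Real.pi * |s - t| * |x| := by
  have h : expFun s x - expFun t x = expFun t x * (expFun (s - t) x - 1) := by
    rw [mul_sub, ← expFun_add_left]; simp
  have h2 : expFun (s - t) x = Complex.exp (Complex.I * (2 * Real.pi * (s - t) * x : ℝ)) := by
    rw [expFun]; congr 1; push_cast; ring
  rw [h, norm_mul, norm_expFun, one_mul, h2]
  refine (Real.norm_exp_I_mul_ofReal_sub_one_le).trans ?_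
  rw [Real.norm_eq_abs, abs_mul, abs_mul, abs_of_pos Real.two_pi_pos]

lemma eq_zero_of_inner_expLp {f : Lp ℂ 2 μ} (h : ∀ t, inner ℂ (expLp μ t) f = 0) : f = 0 := by
  refine (Lp.eq_zero_iff_ae_eq_zero).2 ?_
  refine ae_eq_zero_of_integral_expFun_mul ((Lp.memLp f).integrable (by norm_num)) fun t => ?_
  rw [← h (-t), L2.inner_def]
  refine integral_congr_ae ?_
  filter_upwards [coeFn_expLp (μ := μ) (-t)] with x hx
  rw [hx, RCLike.inner_apply, star_expFun, neg_neg, mul_comm]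

variable (hμ : IsInvariantMeasure 3 cantorB μ) (hr : MeasurePreserving (shiftMap 3 cantorB) μ μ)

include hμ

/-- Almost every `x` satisfies `|x| ≤ 1`, which makes the pointwise Lipschitz bound in the frequency
uniform. -/
lemma continuous_expLp : Continuous (expLp μ) := by
  have hlip : LipschitzWith (2 * Real.pi).toNNReal (expLp μ) := by
    refine LipschitzWith.of_dist_le_mul fun s t => ?_
    rw [dist_eq_norm, Real.dist_eq]
    have hb : ∀ᵐ x ∂μ, ‖(expLp μ s - expLp μ t : Lp ℂ 2 μ) x‖ ≤ 2 * Real.pi * |s - t| := by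
      filter_upwards [Lp.coeFn_sub (expLp μ s) (expLp μ t), coeFn_expLp (μ := μ) s,
        coeFn_expLp (μ := μ) t, hμ.ae_mem_Icc] with x h1 h2 h3 h4
      rw [h1, Pi.sub_apply, h2, h3]
      refine (norm_expFun_sub_le s t x).trans ?_
      have : |x| ≤ 1 := abs_le.2 ⟨by linarith [h4.1], h4.2⟩
      exact mul_le_of_le_one_right (by positivity) this
    have := Lp.norm_le_of_ae_bound (by positivity) hb
    rw [Real.coe_toNNReal _ Real.two_pi_pos.le]
    simpa [measureUnivNNReal] using this
  exact hlip.continuous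

/-- The integrand is `expFun (l' - l)` times the pointwise inner product of `f` and `g` composed
with the shift, and `l' - l = ±3/4`. -/
lemma inner_cuntzOp_of_ne {l l' : ℝ} (hl : l ∈ cantorL) (hl' : l' ∈ cantorL) (hne : l ≠ l')
    (f g : Lp ℂ 2 μ) : inner ℂ (cuntzOp hr l f) (cuntzOp hr l' g) = 0 := by
  have hs : l' - l = 3 / 4 ∨ l' - l = -(3 / 4) := by
    rcases mem_cantorL.1 hl with rfl | rfl <;> rcases mem_cantorL.1 hl' with rfl | rfl
    · exact absurd rfl hne
    · left; ring
    · right; ring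
    · exact absurd rfl hne
  rw [L2.inner_def, ← hμ.integral_expFun_mul_comp_shiftMap hs (L2.integrable_inner (𝕜 := ℂ) f g)]
  refine integral_congr_ae ?_
  filter_upwards [coeFn_cuntzOp hr l f, coeFn_cuntzOp hr l' g] with x h1 h2
  rw [h1, h2, RCLike.inner_apply, RCLike.inner_apply, map_mul, star_expFun, sub_eq_add_neg,
    expFun_add_left]
  ring

lemma cuntzWord_eq_or_inner_eq_zero (w w' : List cantorL) :
    cuntzWord hr w (Lp.const 2 μ (1 : ℂ)) = cuntzWord hr w' (Lp.const 2 μ (1 : ℂ)) ∨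
    inner ℂ (cuntzWord hr w (Lp.const 2 μ (1 : ℂ)))
      (cuntzWord hr w' (Lp.const 2 μ (1 : ℂ))) = 0 := by
  have h0 : (0 : ℝ) ∈ cantorL := by simp [cantorL]
  have hcons : ∀ {l l' : ℝ} {f g : Lp ℂ 2 μ}, l ∈ cantorL → l' ∈ cantorL →
      (f = g ∨ inner ℂ f g = 0) →
      (cuntzOp hr l f = cuntzOp hr l' g ∨ inner ℂ (cuntzOp hr l f) (cuntzOp hr l' g) = 0) := by
    intro l l' f g hl hl' h
    rcases eq_or_ne l l' with rfl | hne
    · rcases h with rfl | h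
      · exact Or.inl rfl
      · right; rw [LinearIsometry.inner_map_map, h]
    · exact Or.inr (inner_cuntzOp_of_ne hμ hr hl hl' hne f g)
  induction w generalizing w' with
  | nil =>
    induction w' with
    | nil => exact Or.inl rfl
    | cons l' w' ih =>
      have := hcons h0 l'.2 ih
      rwa [cuntzWord_nil, cuntzOp_zero_const] at this
  | cons l w ih =>
    cases w' with
    | nil =>
      have := hcons l.2 h0 (ih [])
      rwa [cuntzWord_nil, cuntzOp_zero_const] at this
    | cons l' w' => exact hcons l.2 l'.2 (ih w')

/-- On each branch the right side is a combination of the same exponential in `y`, with the two mask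
values added on the branch of digit `0` and subtracted on that of digit `2`. They are `(1 ± expFun 2
(t / 3)) / 2`, so the sum is `1` and the difference is `expFun 2 (t / 3)`. -/
lemma expLp_eq_add (t : ℝ) :
    expLp μ t = maskFun cantorB (t / 3) • cuntzOp hr 0 (expLp μ (t / 3)) +
      maskFun cantorB ((t - 3 / 4) / 3) • cuntzOp hr (3 / 4) (expLp μ ((t - 3 / 4) / 3)) := by
  refine Lp.ext ?_
  filter_upwards [coeFn_expLp (μ := μ) t, hμ.ae_mem_cantorSet,
    Lp.coeFn_add (maskFun cantorB (t / 3) • cuntzOp hr 0 (expLp μ (t / 3)))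
      (maskFun cantorB ((t - 3 / 4) / 3) • cuntzOp hr (3 / 4) (expLp μ ((t - 3 / 4) / 3))),
    Lp.coeFn_smul (maskFun cantorB (t / 3)) (cuntzOp hr 0 (expLp μ (t / 3))),
    Lp.coeFn_smul (maskFun cantorB ((t - 3 / 4) / 3))
      (cuntzOp hr (3 / 4) (expLp μ ((t - 3 / 4) / 3))),
    coeFn_cuntzOp hr 0 (expLp μ (t / 3)), coeFn_cuntzOp hr (3 / 4) (expLp μ ((t - 3 / 4) / 3)),
    hr.quasiMeasurePreserving.ae (coeFn_expLp (μ := μ) (t / 3)),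
    hr.quasiMeasurePreserving.ae (coeFn_expLp (μ := μ) ((t - 3 / 4) / 3))]
    with x h1 hx h2 h3 h4 h5 h6 h7 h8
  rw [h1, h2, Pi.add_apply, h3, h4, Pi.smul_apply, Pi.smul_apply, h5, h6, h7, h8, smul_eq_mul,
    smul_eq_mul, expFun_zero_left, maskFun_cantorB, maskFun_cantorB]
  have hw : expFun 2 ((t - 3 / 4) / 3) = -expFun 2 (t / 3) := by
    have h : (t - 3 / 4) / 3 = t / 3 + -(1 / 4) := by ring
    rw [h, expFun_add_right, expFun_neg_half (t := 2) (x := -(1 / 4)) (by norm_num)]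
    ring
  rw [hw]
  rw [cantorSet_eq_iUnion_tau] at hx
  rcases hx with ⟨y, hy, rfl⟩ | ⟨y, hy, rfl⟩
  · rw [shiftMap_tau (by simp [cantorB]) hy]
    have e1 : expFun t (tau 3 0 y) = expFun (t / 3) y :=
      expFun_congr (by simp only [tau]; ring)
    have e2 : expFun (3 / 4) (tau 3 0 y) = expFun (1 / 4) y :=
      expFun_congr (by simp only [tau]; ring)
    have e3 : expFun (t / 3) y = expFun (1 / 4) y * expFun ((t - 3 / 4) / 3) y := by
      rw [← expFun_add_left]; congr 1; ring
    rw [e1, e2, e3]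
    ring
  · rw [shiftMap_tau (by simp [cantorB]) hy]
    have ht : tau 3 2 y = y / 3 + 2 / 3 := by simp only [tau]; ring
    have e1 : expFun t (tau 3 2 y) = expFun (t / 3) y * expFun 2 (t / 3) := by
      rw [ht, expFun_add_right]
      congr 1 <;> exact expFun_congr (by ring)
    have e2 : expFun (3 / 4) (tau 3 2 y) = -expFun (1 / 4) y := by
      rw [ht, expFun_add_right, expFun_half (t := 3 / 4) (x := 2 / 3) (by norm_num),
        mul_neg_one]
      congr 1
      exact expFun_congr (by ring)
    have e3 : expFun (t / 3) y = expFun (1 / 4) y * expFun ((t - 3 / 4) / 3) y := by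
      rw [← expFun_add_left]; congr 1; ring
    rw [e1, e2, e3]
    ring

/-! ### The orthonormal basis -/

lemma orthonormal_cuntzWord :
    Orthonormal ℂ (fun v : Set.range fun w : List cantorL =>
      cuntzWord hr w (Lp.const 2 μ (1 : ℂ)) => (v : Lp ℂ 2 μ)) := by
  constructor
  · rintro ⟨_, w, rfl⟩
    exact norm_cuntzWord_const hr w
  · rintro ⟨_, w, rfl⟩ ⟨_, w', rfl⟩ hne
    exact (cuntzWord_eq_or_inner_eq_zero hμ hr w w').resolve_left fun h => hne (Subtype.ext h)

lemma orthogonal_span_cuntzWord :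
    (Submodule.span ℂ (Set.range fun w : List cantorL =>
      cuntzWord hr w (Lp.const 2 μ (1 : ℂ))))ᗮ = ⊥ := by
  set K := Submodule.span ℂ (Set.range fun w : List cantorL =>
      cuntzWord hr w (Lp.const 2 μ (1 : ℂ))) with hK
  have hmem : ∀ w : List cantorL, cuntzWord hr w (Lp.const 2 μ (1 : ℂ)) ∈ K := fun w =>
    Submodule.subset_span ⟨w, rfl⟩
  have h0 : (0 : ℝ) ∈ cantorL := by simp [cantorL]
  have h34 : (3 / 4 : ℝ) ∈ cantorL := by simp [cantorL]
  have hKS : ∀ l ∈ cantorL, ∀ f ∈ K, cuntzOp hr l f ∈ K := by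
    intro l hl
    have : K ≤ K.comap (cuntzOp hr l).toLinearMap := by
      refine Submodule.span_le.2 ?_
      rintro _ ⟨w, rfl⟩
      exact hmem (⟨l, hl⟩ :: w)
    exact fun f hf => this hf
  have hKSc : ∀ l ∈ cantorL, ∀ f ∈ Kᗮᗮ, cuntzOp hr l f ∈ Kᗮᗮ := by
    intro l hl f hf
    rw [Submodule.orthogonal_orthogonal_eq_closure] at hf ⊢
    exact map_mem_closure (cuntzOp hr l).continuous hf (hKS l hl)
  -- Each spanning vector has the form `S_l' g` with `g ∈ K`, the empty word being read as `S_0 1`.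
  -- For `l' = l` the isometry reduces the claim to `f ⟂ g`; otherwise the ranges are orthogonal.
  have hKSo : ∀ l ∈ cantorL, ∀ f ∈ Kᗮ, cuntzOp hr l f ∈ Kᗮ := by
    intro l hl f hf
    have hle : K ≤ (ℂ ∙ cuntzOp hr l f)ᗮ := by
      refine Submodule.span_le.2 ?_
      rintro _ ⟨w, rfl⟩
      refine Submodule.mem_orthogonal_singleton_iff_inner_right.2 ?_
      have hcons : ∀ l' ∈ cantorL, ∀ g ∈ K, inner ℂ (cuntzOp hr l f) (cuntzOp hr l' g) = 0 := by
        intro l' hl' g hg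
        rcases eq_or_ne l l' with rfl | hne
        · rw [LinearIsometry.inner_map_map, Submodule.inner_left_of_mem_orthogonal hg hf]
        · exact inner_cuntzOp_of_ne hμ hr hl hl' hne f g
      cases w with
      | nil =>
        have := hcons 0 h0 _ (hmem [])
        rwa [cuntzWord_nil, cuntzOp_zero_const] at this
      | cons l' w => exact hcons l' l'.2 _ (hmem w)
    refine (Submodule.mem_orthogonal' K _).2 fun g hg => ?_
    exact Submodule.mem_orthogonal_singleton_iff_inner_right.1 (hle hg)
  -- Both `Kᗮ` and `Kᗮᗮ` are invariant under the isometries, so the orthogonal decomposition of `f`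
  -- is mapped to that of its image.
  have hQS : ∀ l ∈ cantorL, ∀ f, Kᗮ.starProjection (cuntzOp hr l f) =
      cuntzOp hr l (Kᗮ.starProjection f) := by
    intro l hl f
    refine Submodule.eq_starProjection_of_mem_orthogonal
      (hKSo l hl _ (Submodule.starProjection_apply_mem _ _)) ?_
    rw [← map_sub]
    exact hKSc l hl _ (Submodule.sub_starProjection_mem_orthogonal _)
  have hzero : ∀ t, ‖Kᗮ.starProjection (expLp μ t)‖ ^ 2 = 0 := by
    refine eq_zero_of_averaging (u := fun t => ‖Kᗮ.starProjection (expLp μ t)‖ ^ 2) ?_ ?_ ?_ ?_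
    · have := continuous_expLp hμ
      fun_prop
    · have h1 : expLp μ 0 ∈ K := expLp_zero (μ := μ) ▸ hmem []
      have h2 : Kᗮ.starProjection (expLp μ 0) = 0 :=
        (Submodule.starProjection_apply_eq_zero_iff _).2 (Submodule.le_orthogonal_orthogonal K h1)
      simp only [h2, norm_zero]; norm_num
    · intro t; positivity
    · intro t
      have horth : inner ℂ
          (maskFun cantorB (t / 3) • cuntzOp hr 0 (Kᗮ.starProjection (expLp μ (t / 3))))
          (maskFun cantorB ((t - 3 / 4) / 3) •
            cuntzOp hr (3 / 4) (Kᗮ.starProjection (expLp μ ((t - 3 / 4) / 3)))) = 0 := by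
        rw [inner_smul_left, inner_smul_right,
          inner_cuntzOp_of_ne hμ hr h0 h34 (by norm_num), mul_zero, mul_zero]
      have hpyth := norm_add_sq_eq_norm_sq_add_norm_sq_of_inner_eq_zero _ _ horth
      -- The shift of the frequency by `-1/4` moves the angle by `-π/2`, so the two squared mask
      -- values add up to one.
      have hcos : Real.cos (2 * Real.pi * ((t - 3 / 4) / 3)) = Real.sin (2 * Real.pi * (t / 3)) := by
        rw [← Real.cos_sub_pi_div_two]; congr 1; ring
      conv_lhs => rw [expLp_eq_add hμ hr t, map_add, map_smul, map_smul, hQS 0 h0, hQS _ h34]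
      rw [sq, hpyth, norm_smul, norm_smul, LinearIsometry.norm_map, LinearIsometry.norm_map,
        ← sq, ← sq, mul_pow, mul_pow, normSq_maskFun_cantorB, normSq_maskFun_cantorB, hcos]
  refine (Submodule.eq_bot_iff _).2 fun f hf => eq_zero_of_inner_expLp fun t => ?_
  have h1 : Kᗮ.starProjection (expLp μ t) = 0 := by simpa using hzero t
  exact Submodule.inner_left_of_mem_orthogonal hf
    ((Submodule.starProjection_apply_eq_zero_iff _).1 h1)

end Cuntz

/-! ### The functions `S_w 1` on cylinders -/

lemma mem_ifsCylinder_succ {n : ℕ} {b : Fin (n + 1) → cantorB} {x : ℝ} :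
    x ∈ ifsCylinder 3 cantorB b ↔
      ∃ y ∈ ifsCylinder 3 cantorB (fun k => b k.succ), tau 3 (b 0) y = x := by
  simp only [ifsCylinder, List.ofFn_succ, Set.mem_image, exists_exists_and_eq_and]
  rfl

lemma ifsCylinder_subset {n : ℕ} (b : Fin n → cantorB) :
    ifsCylinder 3 cantorB b ⊆ cantorSet := by
  induction n with
  | zero =>
    rintro _ ⟨x, hx, rfl⟩
    simpa [attractor_cantorB] using hx
  | succ n ih =>
    intro x hx
    obtain ⟨y, hy, rfl⟩ := mem_ifsCylinder_succ.1 hx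
    exact tau_mem_cantorSet (b 0).2 (ih _ hy)

lemma exists_mem_ifsCylinder (n : ℕ) {x : ℝ} (hx : x ∈ cantorSet) :
    ∃ b : Fin n → cantorB, x ∈ ifsCylinder 3 cantorB b := by
  induction n generalizing x with
  | zero => exact ⟨Fin.elim0, x, by rwa [attractor_cantorB], by simp⟩
  | succ n ih =>
    obtain ⟨d, y, hy, rfl⟩ : ∃ d : cantorB, ∃ y ∈ cantorSet, tau 3 d y = x := by
      rw [cantorSet_eq_iUnion_tau] at hx
      rcases hx with ⟨y, hy, rfl⟩ | ⟨y, hy, rfl⟩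
      · exact ⟨⟨0, by simp [cantorB]⟩, y, hy, rfl⟩
      · exact ⟨⟨2, by simp [cantorB]⟩, y, hy, rfl⟩
    obtain ⟨b, hb⟩ := ih hy
    exact ⟨Fin.cons d b, mem_ifsCylinder_succ.2 ⟨y, by simpa using hb, by simp⟩⟩

/-- At `x = tau 3 (b 0) y` the shift gives `y`, and `e_f(y) = e_{3f}(x) · e^{-2πi b_0 f}` with `f`
the frequency of the tail. The extra factor is the term split off in `phase_succ`. Quantifying over
`b` inside the almost-everywhere statement lets the induction pull back a single null set along the
shift. -/
lemma ae_cuntzWord_eq {μ : Measure ℝ} [IsProbabilityMeasure μ]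
    (hr : MeasurePreserving (shiftMap 3 cantorB) μ μ) {n : ℕ} (l : Fin n → cantorL) :
    ∀ᵐ x ∂μ, ∀ b : Fin n → cantorB, x ∈ ifsCylinder 3 cantorB b →
      cuntzWord hr (List.ofFn l) (Lp.const 2 μ (1 : ℂ)) x =
        expFun (phase 3 (fun k => (b k : ℝ)) (fun k => (l k : ℝ))) 1 *
          expFun (freq 3 (fun k => (l k : ℝ))) x := by
  induction n with
  | zero =>
    filter_upwards [Lp.coeFn_const (p := 2) (μ := μ) (1 : ℂ)] with x hx b _
    rw [List.ofFn_zero, cuntzWord_nil, hx]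
    simp [phase, freq, expFun_zero_left]
  | succ n ih =>
    have ih' := hr.quasiMeasurePreserving.ae (ih fun k => l k.succ)
    rw [List.ofFn_succ, cuntzWord_cons]
    filter_upwards [ih', coeFn_cuntzOp hr (l 0)
      (cuntzWord hr (List.ofFn fun k => l k.succ) (Lp.const 2 μ (1 : ℂ)))] with x h1 h2 b hb
    obtain ⟨y, hy, rfl⟩ := mem_ifsCylinder_succ.1 hb
    have hs := shiftMap_tau (b 0).2 (ifsCylinder_subset _ hy)
    rw [hs] at h1 h2
    rw [h2, h1 _ hy, freq_succ, phase_succ, expFun_add_left, sub_eq_add_neg, expFun_add_left]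
    have e : expFun (3 * freq 3 fun k => (l k.succ : ℝ)) (tau 3 (b 0) y) =
        expFun ((b 0 : ℝ) * freq 3 fun k => (l k.succ : ℝ)) 1 *
          expFun (freq 3 fun k => (l k.succ : ℝ)) y := by
      have hty : tau 3 (b 0) y = (b 0 : ℝ) / 3 + y / 3 := by simp only [tau]; ring
      rw [hty, expFun_add_right]
      congr 1 <;> exact expFun_congr (by ring)
    have e2 : expFun (-((b 0 : ℝ) * freq 3 fun k => (l k.succ : ℝ))) 1 *
        expFun ((b 0 : ℝ) * freq 3 fun k => (l k.succ : ℝ)) 1 = 1 := by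
      rw [← expFun_add_left, neg_add_cancel, expFun_zero_left]
    rw [e]
    linear_combination (-(expFun (phase 3 (fun k => (b k.succ : ℝ)) fun k => (l k.succ : ℝ)) 1 *
      expFun (l 0) (tau 3 (b 0) y) * expFun (freq 3 fun k => (l k.succ : ℝ)) y)) * e2

end PiecewiseExp

theorem mainTheorem7 :
    attractor 3 cantorB = cantorSet ∧
    IsSpectrum (cantorB.image (fun b => (3 : ℝ)⁻¹ * b)) cantorL ∧
    (∀ c : ℝ, IsExtremeCyclePoint 3 cantorB cantorL c ↔ c = 0) ∧
    (∀ C : Set ℝ, IsExtremeCycle 3 cantorB cantorL C ↔ C = {0}) ∧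
    ∀ (μ : Measure ℝ) [IsProbabilityMeasure μ],
      IsInvariantMeasure 3 cantorB μ →
      NoOverlap 3 cantorB μ ∧
      ∃ hr : MeasurePreserving (shiftMap 3 cantorB) μ μ,
        (∃ e : HilbertBasis
              (Set.range fun w : List cantorL =>
                cuntzWord hr w (Lp.const 2 μ (1 : ℂ)))
              ℂ (Lp ℂ 2 μ),
            ∀ v, e v = (v : Lp ℂ 2 μ)) ∧
        ∀ (n : ℕ) (l : Fin n → cantorL),
          (∀ b : Fin n → cantorB,
            expFun (phase 3 (fun k => (b k : ℝ)) (fun k => (l k : ℝ))) 1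
              ∈ ({1, -1} : Set ℂ)) ∧
          ∀ᵐ x ∂μ,
            (∃ b : Fin n → cantorB, x ∈ ifsCylinder 3 cantorB b) ∧
            ∀ b : Fin n → cantorB, x ∈ ifsCylinder 3 cantorB b →
              cuntzWord hr (List.ofFn l) (Lp.const 2 μ (1 : ℂ)) x =
                expFun
                    (phase 3 (fun k => (b k : ℝ)) (fun k => (l k : ℝ))) 1 *
                  expFun (freq 3 (fun k => (l k : ℝ))) x := by
  refine ⟨attractor_cantorB, isSpectrum_cantorL, isExtremeCyclePoint_iff, isExtremeCycle_iff, ?_⟩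
  intro μ _ hμ
  have hr := hμ.measurePreserving_shiftMap
  refine ⟨noOverlap_cantorB μ, hr, ?_, fun n l => ⟨fun b => expFun_phase_mem b l, ?_⟩⟩
  · refine ⟨HilbertBasis.mkOfOrthogonalEqBot (orthonormal_cuntzWord hμ hr) ?_, fun v => ?_⟩
    · rw [Subtype.range_coe]
      exact orthogonal_span_cuntzWord hμ hr
    · rw [HilbertBasis.coe_mkOfOrthogonalEqBot]
  · filter_upwards [hμ.ae_mem_cantorSet, ae_cuntzWord_eq hr l] with x hx hw
    exact ⟨exists_mem_ifsCylinder n hx, hw⟩
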